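/- **Setting.** Let $\mathcal C_{TCM}$ be the category of topos causal models: an object is a triple $M=\langle U,V,F\rangle$ of sets $U$ (exogenous), $V$ (endogenous) and a function $F:U\to V$; an arrow $\langle U,V,F\rangle\to\langle U',V',F'\rangle$ is a pair of functions $h:U\to U'$, $g:V\to V'$ with $g\circ F=F'\circ h$. This category is a topos; its subobject classifier is $\mathrm{true}:\mathbf 1\to\Omega$ with $\Omega=(\{0,\tfrac12,1\}\to\{0,1\})$, $0\mapsto 0$, $\tfrac12\mapsto 1$, $1\mapsto 1$. The types of its Mitchell–Bénabou language are the objects of $\mathcal C_{TCM}$. Terms are built from typed variables by pairing $\langle\sigma,\tau\rangle$, equality $\sigma=\tau$, application $f\circ\sigma$ of arrows $f$ of $\mathcal C_{TCM}$, evaluation $\theta(\sigma)$, membership $\sigma\in\tau$, abstraction $\lambda x\,\sigma$, the connectives $\wedge,\vee,\Rightarrow,\neg$ and the quantifiers $\forall,\exists$. A term of type $A$ whose free variables are among variables of types $M_1,\dots,M_k$ ($k\ge1$) is interpreted in the usual way as an arrow $M_1\times\dots\times M_k\to A$, the logical symbols being interpreted by the internal Heyting algebra operations on $\Omega$ and by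 the internal quantifiers $\forall_B,\exists_B:\Omega^B\to\Omega$. Formulas are the terms of type $\Omega$. For a formula $\phi(x)$, with $x$ of type $M$ (or $x$ a list of variables and $M$ the product of their types), $\{x\mid\phi(x)\}$ is the subobject of $M$ classified by $\phi:M\to\Omega$; for a generalized element $\alpha:N\to M$, one writes $N\Vdash\phi(\alpha)$ if $\alpha$ factors through $\{x\mid\phi(x)\}$. **Theorem.** Let $\alpha:N\to M$ be a generalized element of $M$ in $\mathcal C_{TCM}$, let $\phi(x),\psi(x)$ be formulas with free variable $x$ of type $M$, and let $\chi(x,y)$ be a formula with free variables $x$ of type $M$ and $y$ of type $Y$. Then: 1. $N\Vdash\phi(\alpha)\wedge\psi(\alpha)$ if and only if $N\Vdash\phi(\alpha)$ and $N\Vdash\psi(\alpha)$. 2. $N\Vdash\phi(\alpha)\vee\psi(\alpha)$ if and only if there are arrows $p:O\to N$ and $q:P\to N$ such that the induced arrow $p+q:O+P\to N$ is epic, $O\Vdash\phi(\alpha p)$ and $P\Vdash\psi(\alpha q)$. 3. $N\Vdash\phi(\alpha)\Rightarrow\psi(\alpha)$ if and only if for every arrow $p:O\to N$ such that $O\Vdash\phi(\alpha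 p)$, also $O\Vdash\psi(\alpha p)$. 4. $N\Vdash\neg\phi(\alpha)$ if and only if for every arrow $p:O\to N$ such that $O\Vdash\phi(\alpha p)$, one has $O\cong\mathbf 0$ (the initial object). 5. $N\Vdash\exists y\,\chi(\alpha,y)$ if and only if there are an epic arrow $p:O\to N$ and a generalized element $\beta:O\to Y$ such that $O\Vdash\chi(\alpha p,\beta)$. 6. $N\Vdash\forall y\,\chi(\alpha,y)$ if and only if for every object $O$, every arrow $p:O\to N$ and every generalized element $\beta:O\to Y$, one has $O\Vdash\chi(\alpha p,\beta)$. -/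

import Mathlib

open CategoryTheory Limits MonoidalCategory CartesianMonoidalCategory

universe u

/-! ### The category of topos causal models -/

/-- A topos causal model `⟨U, V, F⟩`: exogenous values `U`, endogenous values `V`, and the
function `F : U → V` that determines the endogenous from the exogenous ones. -/
structure TCM : Type (u + 1) where
  U : Type u
  V : Type u
  F : U → V

namespace TCM

/-- An arrow of causal models is a commutative square. -/
@[ext]
structure Hom (M N : TCM.{u}) : Type u where
  onU : M.U → N.U
  onV : M.V → N.V
  comm : ∀ x, onV (M.F x) = N.F (onU x)

instance : Category TCM.{u} where
  Hom := Hom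
  id M := ⟨id, id, fun _ => rfl⟩
  comp f g := ⟨g.onU ∘ f.onU, g.onV ∘ f.onV, fun x => by simp [f.comm, g.comm]⟩

@[ext]
theorem hom_ext {M N : TCM.{u}} {f g : M ⟶ N} (hU : ∀ x, f.onU x = g.onU x)
    (hV : ∀ x, f.onV x = g.onV x) : f = g :=
  Hom.ext (funext hU) (funext hV)

@[simp]
theorem id_onU (M : TCM.{u}) (x : M.U) : Hom.onU (𝟙 M) x = x := rfl

@[simp]
theorem id_onV (M : TCM.{u}) (x : M.V) : Hom.onV (𝟙 M) x = x := rfl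

@[simp]
theorem comp_onU {L M N : TCM.{u}} (f : L ⟶ M) (g : M ⟶ N) (x : L.U) :
    (f ≫ g).onU x = g.onU (f.onU x) := rfl

@[simp]
theorem comp_onV {L M N : TCM.{u}} (f : L ⟶ M) (g : M ⟶ N) (x : L.V) :
    (f ≫ g).onV x = g.onV (f.onV x) := rfl

/-! ### Finite products, all limits and all colimits -/

/-- The terminal model, the identity of a one-point set. -/
def one : TCM.{u} := ⟨PUnit, PUnit, id⟩

def oneCone : LimitCone (Functor.empty.{0} TCM.{u}) where
  cone := asEmptyCone one
  isLimit := IsTerminal.ofUniqueHom (Y := one) (fun _ => ⟨fun _ => ⟨⟩, fun _ => ⟨⟩, fun _ => rfl⟩)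
    (fun _ _ => rfl)

/-- The product of two models, computed componentwise. -/
def prodObj (M N : TCM.{u}) : TCM.{u} := ⟨M.U × N.U, M.V × N.V, Prod.map M.F N.F⟩

def prodFst (M N : TCM.{u}) : prodObj M N ⟶ M := ⟨Prod.fst, Prod.fst, fun _ => rfl⟩

def prodSnd (M N : TCM.{u}) : prodObj M N ⟶ N := ⟨Prod.snd, Prod.snd, fun _ => rfl⟩

def prodLift {L M N : TCM.{u}} (f : L ⟶ M) (g : L ⟶ N) : L ⟶ prodObj M N :=
  ⟨fun x => (f.onU x, g.onU x), fun x => (f.onV x, g.onV x),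
    fun x => Prod.ext (f.comm x) (g.comm x)⟩

def prodCone (M N : TCM.{u}) : LimitCone (pair M N) where
  cone := BinaryFan.mk (prodFst M N) (prodSnd M N)
  isLimit := BinaryFan.isLimitMk (fun s => prodLift s.fst s.snd) (fun _ => rfl) (fun _ => rfl)
    (fun s m h₁ h₂ => by rw [← h₁, ← h₂]; rfl)

instance : CartesianMonoidalCategory TCM.{u} := .ofChosenFiniteProducts oneCone prodCone

def toArrow : TCM.{u} ⥤ Arrow (Type u) where
  obj M := Arrow.mk (↾M.F)
  map f := Arrow.homMk (↾f.onU) (↾f.onV) (by ext x; exact (f.comm x).symm)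

def ofArrow : Arrow (Type u) ⥤ TCM.{u} where
  obj f := ⟨f.left, f.right, f.hom⟩
  map s := ⟨s.left, s.right, fun x => (ConcreteCategory.congr_hom s.w x).symm⟩

/-- The category of topos causal models is the category of arrows of sets. -/
def equivArrow : TCM.{u} ≌ Arrow (Type u) where
  functor := toArrow
  inverse := ofArrow
  unitIso := NatIso.ofComponents (fun M => Iso.refl M)
  counitIso := NatIso.ofComponents (fun f => Iso.refl f)

instance : HasLimits TCM.{u} := Adjunction.has_limits_of_equivalence equivArrow.functor

instance : HasColimits TCM.{u} := Adjunction.has_colimits_of_equivalence equivArrow.functor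

/-! ### Monomorphisms and images -/

/-- The model with one endogenous and no exogenous value. -/
def dot : TCM.{u} := ⟨PEmpty, PUnit, PEmpty.elim⟩

def pointU {M : TCM.{u}} (x : M.U) : one ⟶ M := ⟨fun _ => x, fun _ => M.F x, fun _ => rfl⟩

def pointV {M : TCM.{u}} (x : M.V) : dot ⟶ M := ⟨PEmpty.elim, fun _ => x, fun y => y.elim⟩

theorem injective_onU {M N : TCM.{u}} (m : M ⟶ N) [Mono m] : Function.Injective m.onU := by
  intro x y h
  have : pointU x ≫ m = pointU y ≫ m := by
    ext z
    · exact h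
    · change m.onV (M.F x) = m.onV (M.F y)
      rw [m.comm, m.comm, h]
  exact congrArg (fun f => Hom.onU f PUnit.unit) ((cancel_mono m).1 this)

theorem injective_onV {M N : TCM.{u}} (m : M ⟶ N) [Mono m] : Function.Injective m.onV := by
  intro x y h
  have : pointV x ≫ m = pointV y ≫ m := by
    ext z
    · exact z.elim
    · exact h
  exact congrArg (fun f => Hom.onV f PUnit.unit) ((cancel_mono m).1 this)

theorem mono_of_injective {M N : TCM.{u}} (m : M ⟶ N) (hU : Function.Injective m.onU)
    (hV : Function.Injective m.onV) : Mono m where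
  right_cancellation f g h := by
    ext x
    · exact hU (congrArg (fun f => Hom.onU f x) h)
    · exact hV (congrArg (fun f => Hom.onV f x) h)

/-- A map into the target of a monomorphism that lands in its range, lifted to its source. -/
noncomputable def liftMono {L M N : TCM.{u}} (m : M ⟶ N) [Mono m] (f : L ⟶ N)
    (hU : ∀ x, ∃ y, m.onU y = f.onU x) (hV : ∀ x, ∃ y, m.onV y = f.onV x) : L ⟶ M where
  onU x := (hU x).choose
  onV x := (hV x).choose
  comm x := injective_onV m (by
    rw [(hV _).choose_spec, m.comm, (hU x).choose_spec, f.comm])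

theorem liftMono_comp {L M N : TCM.{u}} (m : M ⟶ N) [Mono m] (f : L ⟶ N)
    (hU : ∀ x, ∃ y, m.onU y = f.onU x) (hV : ∀ x, ∃ y, m.onV y = f.onV x) :
    liftMono m f hU hV ≫ m = f := by
  ext x
  · exact (hU x).choose_spec
  · exact (hV x).choose_spec

def range {M N : TCM.{u}} (f : M ⟶ N) : TCM.{u} :=
  ⟨Set.range f.onU, Set.range f.onV, fun y => ⟨N.F y, by
    obtain ⟨_, x, rfl⟩ := y; exact ⟨M.F x, f.comm x⟩⟩⟩

def rangeι {M N : TCM.{u}} (f : M ⟶ N) : range f ⟶ N :=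
  ⟨Subtype.val, Subtype.val, fun _ => rfl⟩

instance {M N : TCM.{u}} (f : M ⟶ N) : Mono (rangeι f) :=
  mono_of_injective _ Subtype.val_injective Subtype.val_injective

def rangeFactor {M N : TCM.{u}} (f : M ⟶ N) : MonoFactorisation f where
  I := range f
  m := rangeι f
  e := ⟨fun x => ⟨_, x, rfl⟩, fun x => ⟨_, x, rfl⟩, fun x => Subtype.ext (f.comm x)⟩

instance : HasImages TCM.{u} where
  has_image f := HasImage.mk
    { F := rangeFactor f
      isImage :=
        { lift := fun F' => liftMono F'.m (rangeι f)
            (fun y => by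
              obtain ⟨_, x, rfl⟩ := y
              exact ⟨F'.e.onU x, congrArg (fun f => Hom.onU f x) F'.fac⟩)
            (fun y => by
              obtain ⟨_, x, rfl⟩ := y
              exact ⟨F'.e.onV x, congrArg (fun f => Hom.onV f x) F'.fac⟩)
          lift_fac := fun _ => liftMono_comp _ _ _ _ } }

def zero : TCM.{u} := ⟨PEmpty, PEmpty, PEmpty.elim⟩

def zeroIsInitial : IsInitial zero.{u} :=
  IsInitial.ofUniqueHom (fun _ => ⟨PEmpty.elim, PEmpty.elim, fun x => x.elim⟩)
    (fun _ _ => by ext x <;> exact x.elim)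

instance : InitialMonoClass TCM.{u} :=
  InitialMonoClass.of_isInitial zeroIsInitial fun _ =>
    mono_of_injective _ (fun x => x.elim) (fun x => x.elim)

/-! ### Exponentials -/

/-- The exponential `N ^ M`: exogenous values are the arrows `M ⟶ N`, endogenous values are the
functions from `M.V` to `N.V`. -/
def expObj (M N : TCM.{u}) : TCM.{u} := ⟨M ⟶ N, M.V → N.V, Hom.onV⟩

def expEquiv (M L N : TCM.{u}) : (M ⊗ L ⟶ N) ≃ (L ⟶ expObj M N) where
  toFun f :=
    { onU := fun y =>
        { onU := fun x => f.onU (x, y)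
          onV := fun x => f.onV (x, L.F y)
          comm := fun x => f.comm (x, y) }
      onV := fun y x => f.onV (x, y)
      comm := fun _ => rfl }
  invFun g :=
    { onU := fun z => (g.onU z.2).onU z.1
      onV := fun z => g.onV z.2 z.1
      comm := fun z => (congrFun (g.comm z.2) (M.F z.1)).trans ((g.onU z.2).comm z.1) }
  left_inv _ := rfl
  right_inv g := by
    ext y
    · refine Hom.ext rfl (funext fun x => ?_)
      exact congrFun (g.comm y) x
    · rfl

instance : MonoidalClosed TCM.{u} where
  closed M :=
    { rightAdj := Adjunction.rightAdjointOfEquiv (F := tensorLeft M) (G_obj := expObj M)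
        (expEquiv M) (fun L' L N f g => by
          ext y
          · exact Hom.ext rfl (funext fun x => congrArg (fun z => Hom.onV g (x, z)) (f.comm y))
          · rfl)
      adj := Adjunction.adjunctionOfEquivRight _ _ }

/-! ### The subobject classifier -/

/-- The truth values `0`, `½`, `1`. -/
inductive Three : Type u
  | zero | half | one

/-- The truth values `0`, `1`. -/
inductive Two : Type u
  | zero | one

/-- The object of truth values `{0, ½, 1} → {0, 1}`, with `0 ↦ 0`, `½ ↦ 1`, `1 ↦ 1`. -/
abbrev Omega : TCM.{u} :=
  ⟨Three, Two, fun | .zero => .zero | .half => .one | .one => .one⟩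

def trueΩ : 𝟙_ TCM.{u} ⟶ Omega := ⟨fun _ => .one, fun _ => .one, fun _ => rfl⟩

open Classical in
/-- The characteristic arrow of a monomorphism `m : S ⟶ X`. -/
noncomputable def char {S X : TCM.{u}} (m : S ⟶ X) [Mono m] : X ⟶ Omega where
  onU x := if x ∈ Set.range m.onU then .one else if X.F x ∈ Set.range m.onV then .half else .zero
  onV x := if x ∈ Set.range m.onV then .one else .zero
  comm x := by
    by_cases h : x ∈ Set.range m.onU
    · have h' : X.F x ∈ Set.range m.onV := by
        obtain ⟨y, rfl⟩ := h
        exact ⟨S.F y, m.comm y⟩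
      simp [h, h']
    · by_cases h' : X.F x ∈ Set.range m.onV <;> simp [h, h']

theorem char_onU_eq_one {S X : TCM.{u}} (m : S ⟶ X) [Mono m] (x : X.U) :
    (char m).onU x = .one ↔ ∃ y, m.onU y = x := by
  classical
  change (if _ then _ else if _ then _ else _) = _ ↔ x ∈ Set.range m.onU
  split_ifs <;> simp_all

theorem char_onV_eq_one {S X : TCM.{u}} (m : S ⟶ X) [Mono m] (x : X.V) :
    (char m).onV x = .one ↔ ∃ y, m.onV y = x := by
  classical
  change (if _ then _ else _) = _ ↔ x ∈ Set.range m.onV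
  split_ifs <;> simp_all

theorem isPullback_char {S X : TCM.{u}} (m : S ⟶ X) [Mono m] :
    IsPullback m (isTerminalTensorUnit.from S) (char m) trueΩ := by
  refine ⟨⟨?_⟩, ⟨PullbackCone.IsLimit.mk _ (fun s => liftMono m s.fst ?_ ?_)
    (fun s => liftMono_comp _ _ _ _) (fun s => isTerminalTensorUnit.hom_ext _ _)
    (fun s f hf _ => ?_)⟩⟩
  · ext x
    · exact (char_onU_eq_one m _).2 ⟨x, rfl⟩
    · exact (char_onV_eq_one m _).2 ⟨x, rfl⟩
  · exact fun x => (char_onU_eq_one m _).1 (congrArg (fun f => Hom.onU f x) s.condition)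
  · exact fun x => (char_onV_eq_one m _).1 (congrArg (fun f => Hom.onV f x) s.condition)
  · rw [← cancel_mono m, hf, liftMono_comp]

theorem eq_char {S X : TCM.{u}} (m : S ⟶ X) [Mono m] (c : X ⟶ Omega)
    (h : IsPullback m (isTerminalTensorUnit.from S) c trueΩ) : c = char m := by
  have hU : ∀ x, c.onU x = .one ↔ ∃ y, m.onU y = x := by
    refine fun x => ⟨fun hx => ?_, ?_⟩
    · have w : pointU x ≫ c = isTerminalTensorUnit.from one ≫ trueΩ := by
        ext z
        · exact hx
        · change c.onV (X.F x) = .one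
          rw [c.comm, hx]
      exact ⟨(h.lift _ _ w).onU ⟨⟩, congrArg (fun f : one ⟶ X => Hom.onU f PUnit.unit) (h.lift_fst _ _ w)⟩
    · rintro ⟨y, rfl⟩
      exact congrArg (fun f => Hom.onU f y) h.w
  have hV : ∀ x, c.onV x = .one ↔ ∃ y, m.onV y = x := by
    refine fun x => ⟨fun hx => ?_, ?_⟩
    · have w : pointV x ≫ c = isTerminalTensorUnit.from dot ≫ trueΩ := by
        ext z
        · exact z.elim
        · exact hx
      exact ⟨(h.lift _ _ w).onV ⟨⟩, congrArg (fun f : dot ⟶ X => Hom.onV f PUnit.unit) (h.lift_fst _ _ w)⟩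
    · rintro ⟨y, rfl⟩
      exact congrArg (fun f => Hom.onV f y) h.w
  have eV : ∀ x, c.onV x = (char m).onV x := by
    intro x
    have := (hV x).trans (char_onV_eq_one m x).symm
    generalize c.onV x = a at *
    generalize (char m).onV x = b at *
    cases a <;> cases b <;> simp_all
  ext x
  · have h₁ := (hU x).trans (char_onU_eq_one m x).symm
    have h₂ : Omega.F (c.onU x) = Omega.F ((char m).onU x) := by
      rw [← c.comm, ← (char m).comm, eV]
    generalize c.onU x = a at *
    generalize (char m).onU x = b at *
    cases a <;> cases b <;> simp_all [Omega]
  · exact eV x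

/-- `trueΩ : 1 ⟶ Ω` is a subobject classifier. -/
noncomputable def classifier : Subobject.Classifier TCM.{u} :=
  .mkOfTerminalΩ₀ (𝟙_ TCM) isTerminalTensorUnit Omega trueΩ (fun m _ => char m)
    (fun m _ => isPullback_char m) (fun m _ c h => eq_char m c h)

instance : HasSubobjectClassifier TCM.{u} := ⟨⟨classifier⟩⟩

instance {X : TCM.{u}} (x : 𝟙_ TCM ⟶ X) : Mono x := isTerminalTensorUnit.mono_from x

/-- The characteristic arrow of a subobject. -/
noncomputable def charSub {X : TCM.{u}} (S : Subobject X) : X ⟶ Omega := char S.arrow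

/-- The subobject `{x | f x}` of `X` classified by `f : X ⟶ Ω`. -/
noncomputable def extension {X : TCM.{u}} (f : X ⟶ Omega) : Subobject X :=
  (Subobject.pullback f).obj (Subobject.mk trueΩ)

/-! ### The logical operations on `Ω` -/

/-- `∧ : Ω × Ω ⟶ Ω`, the meet of the two generic subobjects. -/
noncomputable def andΩ : Omega ⊗ Omega ⟶ Omega.{u} :=
  charSub (extension (fst Omega Omega) ⊓ extension (snd Omega Omega))

/-- `∨ : Ω × Ω ⟶ Ω`, the join of the two generic subobjects. -/
noncomputable def orΩ : Omega ⊗ Omega ⟶ Omega.{u} :=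
  charSub (extension (fst Omega Omega) ⊔ extension (snd Omega Omega))

/-- `⇒ : Ω × Ω ⟶ Ω`, the characteristic arrow of the order relation `{(a, b) | a ∧ b = a}`. -/
noncomputable def impΩ : Omega ⊗ Omega ⟶ Omega.{u} :=
  charSub (equalizerSubobject andΩ (fst Omega Omega))

/-- `false : 1 ⟶ Ω`, the characteristic arrow of the least subobject of `1`. -/
noncomputable def falseΩ : 𝟙_ TCM.{u} ⟶ Omega := charSub ⊥

/-- `¬ : Ω ⟶ Ω`, that is `a ↦ (a ⇒ false)`. -/
noncomputable def notΩ : Omega ⟶ Omega.{u} := lift (𝟙 Omega) (toUnit Omega ≫ falseΩ) ≫ impΩ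

instance (B : TCM.{u}) : Mono (lift (𝟙 B) (𝟙 B)) := mono_of_mono_fac (lift_fst (𝟙 B) (𝟙 B))

/-- Equality `δ : B × B ⟶ Ω`, the characteristic arrow of the diagonal. -/
noncomputable def eqΩ (B : TCM.{u}) : B ⊗ B ⟶ Omega := char (lift (𝟙 B) (𝟙 B))

/-- The power object `Ω ^ B`. -/
noncomputable abbrev power (B : TCM.{u}) : TCM.{u} := (ihom B).obj Omega

/-- Membership `B × Ω ^ B ⟶ Ω`. -/
noncomputable def memΩ (B : TCM.{u}) : B ⊗ power B ⟶ Omega := (ihom.ev B).app Omega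

/-- `∀ : Ω ^ B ⟶ Ω`, the characteristic arrow of the name `1 ⟶ Ω ^ B` of the maximal subobject
of `B`. -/
noncomputable def allΩ (B : TCM.{u}) : power B ⟶ Omega :=
  char (MonoidalClosed.curry (toUnit (B ⊗ 𝟙_ TCM) ≫ trueΩ))

/-- `∃ : Ω ^ B ⟶ Ω`, the characteristic arrow of the image of the membership relation
`{(b, S) | b ∈ S}` under the projection `B × Ω ^ B ⟶ Ω ^ B`. -/
noncomputable def exΩ (B : TCM.{u}) : power B ⟶ Omega :=
  charSub (imageSubobject ((extension (memΩ B)).arrow ≫ snd B (power B)))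

end TCM

/-! ### The Mitchell–Bénabou language -/

/-- A non-empty list of variables with their types, the types being causal models. A closed
formula is one in the context of a single dummy variable of type `1`. -/
inductive Ctx : Type (u + 1)
  | single (M : TCM.{u}) : Ctx
  | cons (B : TCM.{u}) (Γ : Ctx) : Ctx

/-- The product of the types of the variables. For one variable of type `M` it is `M` itself. -/
def Ctx.obj : Ctx.{u} → TCM.{u}
  | single M => M
  | cons B Γ => B ⊗ Γ.obj

theorem Ctx.obj_single (M : TCM.{u}) : (Ctx.single M).obj = M := rfl

/-- `Var Γ A` is the type of those variables of `Γ` that have type `A`. -/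
inductive Var : Ctx.{u} → TCM.{u} → Type (u + 1)
  | only (M : TCM.{u}) : Var (.single M) M
  | head (B : TCM.{u}) (Γ : Ctx.{u}) : Var (.cons B Γ) B
  | tail (B : TCM.{u}) {Γ : Ctx.{u}} {A : TCM.{u}} (x : Var Γ A) : Var (.cons B Γ) A

/-- `Term Γ A` is the type of the terms of type `A` with free variables in `Γ`. In `lam`, `all`
and `ex` the first variable of the longer context is the bound one. -/
inductive Term : Ctx.{u} → TCM.{u} → Type (u + 1)
  | var {Γ A} (x : Var Γ A) : Term Γ A
  | pair {Γ A B} (σ : Term Γ A) (τ : Term Γ B) : Term Γ (A ⊗ B)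
  | eq {Γ B} (σ τ : Term Γ B) : Term Γ TCM.Omega
  | app {Γ A B} (f : A ⟶ B) (σ : Term Γ A) : Term Γ B
  | eval {Γ B C} (θ : Term Γ ((ihom C).obj B)) (σ : Term Γ C) : Term Γ B
  | mem {Γ B} (σ : Term Γ B) (τ : Term Γ (TCM.power B)) : Term Γ TCM.Omega
  | lam {Γ B C} (σ : Term (.cons C Γ) B) : Term Γ ((ihom C).obj B)
  | and {Γ} (φ ψ : Term Γ TCM.Omega) : Term Γ TCM.Omega
  | or {Γ} (φ ψ : Term Γ TCM.Omega) : Term Γ TCM.Omega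
  | imp {Γ} (φ ψ : Term Γ TCM.Omega) : Term Γ TCM.Omega
  | not {Γ} (φ : Term Γ TCM.Omega) : Term Γ TCM.Omega
  | all {Γ B} (φ : Term (.cons B Γ) TCM.Omega) : Term Γ TCM.Omega
  | ex {Γ B} (φ : Term (.cons B Γ) TCM.Omega) : Term Γ TCM.Omega

/-- Formulas are terms of type `Ω`. -/
abbrev Formula (Γ : Ctx.{u}) : Type (u + 1) := Term Γ TCM.Omega

/-- A variable is interpreted by the identity, precomposed with a projection. -/
def Var.interp {Γ : Ctx.{u}} {A : TCM.{u}} : Var Γ A → (Γ.obj ⟶ A)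
  | .only M => 𝟙 M
  | .head B Γ => fst B Γ.obj
  | .tail B (Γ := Γ) x => snd B Γ.obj ≫ x.interp

/-- The interpretation of a term of type `A` in the context `Γ` as an arrow `Γ.obj ⟶ A`. -/
noncomputable def Term.interp {Γ : Ctx.{u}} {A : TCM.{u}} : Term Γ A → (Γ.obj ⟶ A)
  | .var x => x.interp
  | .pair σ τ => lift σ.interp τ.interp
  | .eq (B := B) σ τ => lift σ.interp τ.interp ≫ TCM.eqΩ B
  | .app f σ => σ.interp ≫ f
  | .eval (B := B) (C := C) θ σ => lift σ.interp θ.interp ≫ (ihom.ev C).app B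
  | .mem (B := B) σ τ => lift σ.interp τ.interp ≫ TCM.memΩ B
  | .lam σ => MonoidalClosed.curry σ.interp
  | .and φ ψ => lift φ.interp ψ.interp ≫ TCM.andΩ
  | .or φ ψ => lift φ.interp ψ.interp ≫ TCM.orΩ
  | .imp φ ψ => lift φ.interp ψ.interp ≫ TCM.impΩ
  | .not φ => φ.interp ≫ TCM.notΩ
  | .all (B := B) φ => MonoidalClosed.curry φ.interp ≫ TCM.allΩ B
  | .ex (B := B) φ => MonoidalClosed.curry φ.interp ≫ TCM.exΩ B

/-- `Forces α φ` is the forcing relation `N ⊩ φ(α)` at the generalized element `α : N ⟶ Γ.obj`: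
`α` factors through the subobject `{x | φ(x)}`. -/
def Forces {N : TCM.{u}} {Γ : Ctx.{u}} (α : N ⟶ Γ.obj) (φ : Formula Γ) : Prop :=
  (TCM.extension φ.interp).Factors α

/-!
Each logical operation is the characteristic arrow of a generic meet, join, equalizer, image or name
of the maximal subobject, and `extension` inverts `charSub`, so forcing asks when an arrow factors
through such a subobject. For joins and images the reason is that epimorphisms are stable under
pullback and coproducts are universal: an arrow that factors through a join or an image lifts to the
coproduct or to the source after passing to an epimorphic cover. Conversely, factorization descends
along epimorphisms because every monomorphism is strong.
-/

section SubobjectFactors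

variable {C : Type*} [Category* C]

theorem subobject_le_iff_factors {X : C} {S T : Subobject X} :
    S ≤ T ↔ ∀ (O : C) (p : O ⟶ X), S.Factors p → T.Factors p :=
  ⟨fun h _ p => Subobject.factors_of_le p h,
    fun h => Subobject.le_of_factors (h _ _ S.factors_self)⟩

theorem factors_epi_comp_iff [StrongMonoCategory C] {O N X : C} (S : Subobject X) (p : O ⟶ N)
    [Epi p] (a : N ⟶ X) : S.Factors (p ≫ a) ↔ S.Factors a := by
  refine ⟨fun h => ?_, Subobject.factors_of_factors_right p⟩
  have := strongMono_of_mono S.arrow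
  have sq : CommSq (S.factorThru (p ≫ a) h) p S.arrow a := ⟨S.factorThru_arrow _ h⟩
  rw [← sq.fac_right]
  exact Subobject.factors_comp_arrow sq.lift

theorem bot_factors_iff_nonempty_iso_initial [HasInitial C] [HasStrictInitialObjects C]
    {O X : C} (a : O ⟶ X) : (⊥ : Subobject X).Factors a ↔ Nonempty (O ≅ ⊥_ C) := by
  constructor
  · intro h
    exact ⟨asIso (Subobject.factorThru ⊥ a h ≫ Subobject.botCoeIsoInitial.hom)⟩
  · rintro ⟨i⟩
    have : a = (i.hom ≫ Subobject.botCoeIsoInitial.inv) ≫ (⊥ : Subobject X).arrow :=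
      (initialIsInitial.ofIso i.symm).hom_ext _ _
    rw [this]
    exact Subobject.factors_comp_arrow _

theorem sup_eq_imageSubobject_coprod_desc [HasImages C] [HasBinaryCoproducts C] {X : C}
    (A B : Subobject X) : A ⊔ B = imageSubobject (coprod.desc A.arrow B.arrow) := by
  apply le_antisymm
  · refine sup_le (Subobject.le_of_factors ?_) (Subobject.le_of_factors ?_)
    · simpa only [coprod.inl_desc] using
        imageSubobject_factors_comp_self (coprod.desc A.arrow B.arrow) coprod.inl
    · simpa only [coprod.inr_desc] using
        imageSubobject_factors_comp_self (coprod.desc A.arrow B.arrow) coprod.inr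
  · refine imageSubobject_le _
      (coprod.desc (Subobject.ofLE A _ le_sup_left) (Subobject.ofLE B _ le_sup_right)) ?_
    ext <;> simp

theorem epi_coprod_desc_pullback_fst [HasPullbacks C] [FinitaryPreExtensive C] {T A B : C}
    (s : T ⟶ A ⨿ B) :
    Epi (coprod.desc (pullback.fst s (coprod.inl : A ⟶ A ⨿ B)) (pullback.fst s coprod.inr)) := by
  obtain ⟨isColimit⟩ := FinitaryPreExtensive.universal' _ (coprodIsCoprod A B)
    (BinaryCofan.mk (pullback.fst s coprod.inl) (pullback.fst s coprod.inr))
    (mapPair (pullback.snd _ _) (pullback.snd _ _)) s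
    (by ext ⟨⟨⟩⟩ <;> exact pullback.condition.symm) (.of_discrete _)
    (by rintro ⟨⟨⟩⟩ <;> exact IsPullback.of_hasPullback _ _)
  refine ⟨fun f g h => ?_⟩
  have h_inl : pullback.fst s coprod.inl ≫ f = pullback.fst s coprod.inl ≫ g := by
    simpa only [coprod.inl_desc_assoc] using coprod.inl ≫= h
  have h_inr : pullback.fst s coprod.inr ≫ f = pullback.fst s coprod.inr ≫ g := by
    simpa only [coprod.inr_desc_assoc] using coprod.inr ≫= h
  exact BinaryCofan.IsColimit.hom_ext isColimit h_inl h_inr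

variable [StrongMonoCategory C] [HasPullbacks C] [HasEqualizers C] [HasImages C]
  [(MorphismProperty.epimorphisms C).IsStableUnderBaseChange]

theorem imageSubobject_factors_iff {M N X : C} (g : M ⟶ X) (a : N ⟶ X) :
    (imageSubobject g).Factors a ↔
      ∃ (O : C) (p : O ⟶ N) (s : O ⟶ M), Epi p ∧ s ≫ g = p ≫ a := by
  constructor
  · intro h
    let e := factorThruImageSubobject g
    let t := (imageSubobject g).factorThru a h
    have epi_snd : Epi (pullback.snd e t) :=
      MorphismProperty.pullback_snd (P := .epimorphisms C) e t (inferInstanceAs (Epi e))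
    refine ⟨pullback e t, pullback.snd e t, pullback.fst e t, epi_snd, ?_⟩
    calc pullback.fst e t ≫ g
        = pullback.fst e t ≫ e ≫ (imageSubobject g).arrow := by rw [imageSubobject_arrow_comp]
      _ = pullback.snd e t ≫ t ≫ (imageSubobject g).arrow := pullback.condition_assoc _
      _ = pullback.snd e t ≫ a := by rw [Subobject.factorThru_arrow]
  · rintro ⟨O, p, s, _, h⟩
    rw [← factors_epi_comp_iff _ p, ← h]
    exact imageSubobject_factors_comp_self g s

theorem sup_factors_iff [FinitaryPreExtensive C] {N X : C} (A B : Subobject X) (a : N ⟶ X) :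
    (A ⊔ B).Factors a ↔ ∃ (O P : C) (p : O ⟶ N) (q : P ⟶ N),
      Epi (coprod.desc p q) ∧ A.Factors (p ≫ a) ∧ B.Factors (q ≫ a) := by
  rw [sup_eq_imageSubobject_coprod_desc, imageSubobject_factors_iff]
  constructor
  · rintro ⟨T, r, s, _, h⟩
    have epi_fst := epi_coprod_desc_pullback_fst s
    refine ⟨_, _, pullback.fst s coprod.inl ≫ r, pullback.fst s coprod.inr ≫ r, ?_, ?_, ?_⟩
    · rw [← coprod.desc_comp]
      infer_instance
    · rw [Category.assoc, ← h, pullback.condition_assoc, coprod.inl_desc]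
      exact Subobject.factors_comp_arrow _
    · rw [Category.assoc, ← h, pullback.condition_assoc, coprod.inr_desc]
      exact Subobject.factors_comp_arrow _
  · rintro ⟨O, P, p, q, epi_desc, hp, hq⟩
    refine ⟨O ⨿ P, coprod.desc p q, coprod.map (A.factorThru _ hp) (B.factorThru _ hq),
      epi_desc, ?_⟩
    ext <;> simp

theorem imageSubobject_arrow_snd_factors_iff [CartesianMonoidalCategory C] {B X N : C}
    (S : Subobject (B ⊗ X)) (c : N ⟶ X) :
    (imageSubobject (S.arrow ≫ snd B X)).Factors c ↔
      ∃ (O : C) (p : O ⟶ N) (b : O ⟶ B), Epi p ∧ S.Factors (lift b (p ≫ c)) := by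
  rw [imageSubobject_factors_iff]
  refine exists_congr fun O => exists_congr fun p => ⟨?_, ?_⟩
  · rintro ⟨s, epi_p, hs⟩
    refine ⟨s ≫ S.arrow ≫ fst B X, epi_p, ?_⟩
    rw [← hs, ← comp_lift, ← comp_lift, lift_fst_snd, Category.comp_id]
    exact Subobject.factors_comp_arrow s
  · rintro ⟨b, epi_p, hb⟩
    exact ⟨S.factorThru _ hb, epi_p, by rw [Subobject.factorThru_arrow_assoc, lift_snd]⟩

end SubobjectFactors

instance (K D : Type*) [Category* K] [Category* D] [HasPullbacks D] [HasPushouts D]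
    [(MorphismProperty.epimorphisms D).IsStableUnderBaseChange] :
    (MorphismProperty.epimorphisms (K ⥤ D)).IsStableUnderBaseChange := by
  rw [← MorphismProperty.functorCategory_epimorphisms]
  infer_instance

namespace TCM

/-- The category of topos causal models as a category of functors, which unlike `equivArrow` gives
access to the results that are proved pointwise for functor categories. -/
def equivComposableArrows : TCM.{u} ≌ ComposableArrows (Type u) 1 where
  functor :=
    { obj M := .mk₁ (↾M.F)
      map f := ComposableArrows.homMk₁ (↾f.onU) (↾f.onV) (by ext x; exact f.comm x) }
  inverse :=
    { obj A := ⟨A.obj 0, A.obj 1, A.map' 0 1⟩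
      map f := ⟨f.app 0, f.app 1, fun x =>
        ConcreteCategory.congr_hom (f.naturality (homOfLE (Fin.zero_le 1))) x⟩ }
  unitIso := NatIso.ofComponents (fun M => Iso.refl M)
  counitIso := NatIso.ofComponents (fun A => ComposableArrows.isoMk₁ (Iso.refl _) (Iso.refl _))

instance : FinitaryExtensive TCM.{u} :=
  finitaryExtensive_of_preserves_and_reflects_isomorphism equivComposableArrows.functor

instance : (MorphismProperty.epimorphisms TCM.{u}).IsStableUnderBaseChange where
  of_isPullback {_ _ _ _ _ g _ g'} sq (hg : Epi g) := by
    let E := equivComposableArrows.{u}.functor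
    have epi_map : Epi (E.map g') :=
      MorphismProperty.of_isPullback (P := .epimorphisms _) (sq.map E)
        (inferInstanceAs (Epi (E.map g)))
    exact E.epi_of_epi_map epi_map

theorem extension_char {S X : TCM.{u}} (m : S ⟶ X) [Mono m] :
    extension (char m) = Subobject.mk m :=
  classifier.pullback_χ_obj_mk_truth m

theorem extension_charSub {X : TCM.{u}} (S : Subobject X) : extension (charSub S) = S :=
  (extension_char S.arrow).trans (Subobject.mk_arrow S)

theorem extension_injective {X : TCM.{u}} :
    Function.Injective (extension : (X ⟶ Omega) → Subobject X) :=
  Function.LeftInverse.injective (g := charSub) fun f =>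
    classifier.χ_pullback_obj_mk_truth_arrow f

theorem extension_comp {N X : TCM.{u}} (a : N ⟶ X) (f : X ⟶ Omega) :
    extension (a ≫ f) = (Subobject.pullback a).obj (extension f) :=
  Subobject.pullback_comp a f _

theorem extension_comp_factors_iff {N X Y : TCM.{u}} (f : X ⟶ Y) (g : Y ⟶ Omega) (a : N ⟶ X) :
    (extension (f ≫ g)).Factors a ↔ (extension g).Factors (a ≫ f) := by
  rw [extension_comp, pullback_factors_iff]

theorem extension_lift_andΩ {X : TCM.{u}} (f g : X ⟶ Omega) :
    extension (lift f g ≫ andΩ) = extension f ⊓ extension g := by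
  rw [extension_comp, andΩ, extension_charSub, Subobject.inf_pullback, ← extension_comp,
    ← extension_comp, lift_fst, lift_snd]

theorem extension_lift_andΩ_factors_iff {N X : TCM.{u}} (f g : X ⟶ Omega) (a : N ⟶ X) :
    (extension (lift f g ≫ andΩ)).Factors a ↔
      (extension f).Factors a ∧ (extension g).Factors a := by
  rw [extension_lift_andΩ, Subobject.inf_factors]

theorem extension_lift_orΩ_factors_iff {N X : TCM.{u}} (f g : X ⟶ Omega) (a : N ⟶ X) :
    (extension (lift f g ≫ orΩ)).Factors a ↔ ∃ (O P : TCM.{u}) (p : O ⟶ N) (q : P ⟶ N),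
      Epi (coprod.desc p q) ∧ (extension f).Factors (p ≫ a) ∧ (extension g).Factors (q ≫ a) := by
  rw [extension_comp_factors_iff, orΩ, extension_charSub, sup_factors_iff]
  simp only [← extension_comp_factors_iff, Category.assoc, lift_fst, lift_snd]

theorem extension_lift_impΩ_factors_iff {N X : TCM.{u}} (f g : X ⟶ Omega) (a : N ⟶ X) :
    (extension (lift f g ≫ impΩ)).Factors a ↔
      ∀ (O : TCM.{u}) (p : O ⟶ N),
        (extension f).Factors (p ≫ a) → (extension g).Factors (p ≫ a) := by
  rw [extension_comp_factors_iff, impΩ, extension_charSub, equalizerSubobject_factors_iff,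
    comp_lift, lift_fst, ← extension_injective.eq_iff, extension_lift_andΩ, inf_eq_left,
    subobject_le_iff_factors]
  simp only [extension_comp_factors_iff]

theorem extension_comp_notΩ_factors_iff {N X : TCM.{u}} (f : X ⟶ Omega) (a : N ⟶ X) :
    (extension (f ≫ notΩ)).Factors a ↔
      ∀ (O : TCM.{u}) (p : O ⟶ N),
        (extension f).Factors (p ≫ a) → Nonempty (O ≅ ⊥_ TCM.{u}) := by
  rw [notΩ, comp_lift_assoc, Category.comp_id, extension_lift_impΩ_factors_iff]
  simp only [extension_comp_factors_iff, falseΩ, extension_charSub,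
    bot_factors_iff_nonempty_iso_initial]

theorem extension_memΩ_factors_lift_iff {N X B : TCM.{u}} (f : B ⊗ X ⟶ Omega) (b : N ⟶ B)
    (a : N ⟶ X) :
    (extension (memΩ B)).Factors (lift b (a ≫ MonoidalClosed.curry f)) ↔
      (extension f).Factors (lift b a) := by
  rw [← lift_whiskerLeft, ← extension_comp_factors_iff, memΩ,
    MonoidalClosed.whiskerLeft_curry_ihom_ev_app]

theorem extension_curry_exΩ_factors_iff {N X B : TCM.{u}} (f : B ⊗ X ⟶ Omega) (a : N ⟶ X) :
    (extension (MonoidalClosed.curry f ≫ exΩ B)).Factors a ↔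
      ∃ (O : TCM.{u}) (p : O ⟶ N) (b : O ⟶ B),
        Epi p ∧ (extension f).Factors (lift b (p ≫ a)) := by
  rw [extension_comp_factors_iff, exΩ, extension_charSub, imageSubobject_arrow_snd_factors_iff]
  simp only [← Category.assoc, extension_memΩ_factors_lift_iff]

theorem extension_comp_trueΩ {X : TCM.{u}} (t : X ⟶ 𝟙_ TCM) : extension (t ≫ trueΩ) = ⊤ := by
  rw [extension_comp, extension, Subobject.pullback_self, Subobject.pullback_top]

theorem extension_allΩ_factors_curry_iff {N B : TCM.{u}} (f : B ⊗ N ⟶ Omega) :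
    (extension (allΩ B)).Factors (MonoidalClosed.curry f) ↔ extension f = ⊤ := by
  rw [allΩ, extension_char, ← extension_comp_trueΩ (toUnit _), extension_injective.eq_iff]
  have curry_true (s : N ⟶ 𝟙_ TCM) :
      s ≫ MonoidalClosed.curry (toUnit (B ⊗ 𝟙_ TCM) ≫ trueΩ) =
        MonoidalClosed.curry (toUnit (B ⊗ N) ≫ trueΩ) := by
    rw [← MonoidalClosed.curry_natural_left, comp_toUnit_assoc]
  constructor
  · rintro ⟨s, hs⟩
    exact MonoidalClosed.curry_injective (hs.symm.trans (curry_true s))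
  · rintro rfl
    exact ⟨toUnit N, curry_true _⟩

theorem extension_curry_allΩ_factors_iff {N X B : TCM.{u}} (f : B ⊗ X ⟶ Omega) (a : N ⟶ X) :
    (extension (MonoidalClosed.curry f ≫ allΩ B)).Factors a ↔
      ∀ (O : TCM.{u}) (p : O ⟶ N) (b : O ⟶ B), (extension f).Factors (lift b (p ≫ a)) := by
  rw [extension_comp_factors_iff, ← MonoidalClosed.curry_natural_left,
    extension_allΩ_factors_curry_iff, ← top_le_iff, subobject_le_iff_factors]
  simp only [Subobject.top_factors, forall_const, extension_comp_factors_iff]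
  refine forall_congr' fun O => ⟨fun h p b => ?_, fun h q => ?_⟩
  · rw [← lift_whiskerLeft]
    exact h (lift b p)
  · have := h (q ≫ snd B N) (q ≫ fst B N)
    rwa [← lift_whiskerLeft, ← comp_lift, lift_fst_snd, Category.comp_id] at this

end TCM

theorem mainTheorem6 {N : TCM.{u}} {Γ : Ctx.{u}} (α : N ⟶ Γ.obj) :
    (∀ φ ψ : Formula Γ, Forces α (φ.and ψ) ↔ Forces α φ ∧ Forces α ψ) ∧
    (∀ φ ψ : Formula Γ, Forces α (φ.or ψ) ↔
      ∃ (O P : TCM.{u}) (p : O ⟶ N) (q : P ⟶ N),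
        Epi (coprod.desc p q) ∧ Forces (p ≫ α) φ ∧ Forces (q ≫ α) ψ) ∧
    (∀ φ ψ : Formula Γ, Forces α (φ.imp ψ) ↔
      ∀ (O : TCM.{u}) (p : O ⟶ N), Forces (p ≫ α) φ → Forces (p ≫ α) ψ) ∧
    (∀ φ : Formula Γ, Forces α φ.not ↔
      ∀ (O : TCM.{u}) (p : O ⟶ N), Forces (p ≫ α) φ → Nonempty (O ≅ ⊥_ TCM.{u})) ∧
    (∀ (Y : TCM.{u}) (φ : Formula (.cons Y Γ)), Forces α φ.ex ↔
      ∃ (O : TCM.{u}) (p : O ⟶ N) (β : O ⟶ Y),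
        Epi p ∧ Forces (Γ := .cons Y Γ) (lift β (p ≫ α)) φ) ∧
    (∀ (Y : TCM.{u}) (φ : Formula (.cons Y Γ)), Forces α φ.all ↔
      ∀ (O : TCM.{u}) (p : O ⟶ N) (β : O ⟶ Y),
        Forces (Γ := .cons Y Γ) (lift β (p ≫ α)) φ) :=
  ⟨fun _ _ => TCM.extension_lift_andΩ_factors_iff _ _ α,
    fun _ _ => TCM.extension_lift_orΩ_factors_iff _ _ α,
    fun _ _ => TCM.extension_lift_impΩ_factors_iff _ _ α,
    fun _ => TCM.extension_comp_notΩ_factors_iff _ α,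
    fun _ _ => TCM.extension_curry_exΩ_factors_iff _ α,
    fun _ _ => TCM.extension_curry_allΩ_factors_iff _ α⟩
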